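/- For a smooth manifold $M$ and an integer $k\ge 0$, let $\Omega^k(M)$ be the space of smooth real-valued differential $k$-forms on $M$ (with $\Omega^{-1}(M)=0$), let $Z^k(M)=\{\omega\in\Omega^k(M) : d\omega=0\}$ be the space of closed forms and $B^k(M)=d\,\Omega^{k-1}(M)$ the space of exact forms. Let $$\overline{Z}^k(M)=\{\lambda\in Z^k(M) : \text{there are a compact set } K\subseteq M \text{ and } \nu\in\Omega^{k-1}(M\setminus K) \text{ with } d\nu=\lambda|_{M\setminus K}\}$$ be the space of closed $k$-forms that are exact outside a compact set. Then $B^k(M)\subseteq\overline{Z}^k(M)$, and one sets $$c_k(M)=\dim_{\mathbb R}\,\overline{Z}^k(M)/B^k(M).$$ Let $U\subseteq S^2$ be an open subset of the $2$-sphere. Then $c_1(U)=0$. -/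

import Mathlib

open scoped Manifold ContDiff Topology

noncomputable section

namespace OpenGenus

variable (E : Type*) [NormedAddCommGroup E] [NormedSpace ℝ E]
variable (M : Type*) [TopologicalSpace M] [ChartedSpace E M]

/-- A (not necessarily smooth) real-valued differential `k`-form on the manifold `M` modelled
on `E`: an alternating `k`-linear form on each tangent space. -/
def RoughForm (k : ℕ) : Type _ :=
  (x : M) → (TangentSpace 𝓘(ℝ, E) x) [⋀^Fin k]→L[ℝ] ℝ

instance (k : ℕ) : AddCommGroup (RoughForm E M k) :=
  inferInstanceAs (AddCommGroup ((x : M) → (TangentSpace 𝓘(ℝ, E) x) [⋀^Fin k]→L[ℝ] ℝ))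

instance (k : ℕ) : Module ℝ (RoughForm E M k) :=
  inferInstanceAs (Module ℝ ((x : M) → (TangentSpace 𝓘(ℝ, E) x) [⋀^Fin k]→L[ℝ] ℝ))

variable {E M}

@[simp] lemma RoughForm.zero_apply {k : ℕ} (x : M) : (0 : RoughForm E M k) x = 0 := rfl

@[simp] lemma RoughForm.add_apply {k : ℕ} (α β : RoughForm E M k) (x : M) :
    (α + β) x = α x + β x := rfl

@[simp] lemma RoughForm.smul_apply {k : ℕ} (c : ℝ) (α : RoughForm E M k) (x : M) :
    (c • α) x = c • α x := rfl

/-- The expression of a form `α` in a chart `e`, that is, the pullback `(e⁻¹)^* α`, a form on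
`e.target` (with irrelevant values outside `e.target`). -/
def localRep {k : ℕ} (e : OpenPartialHomeomorph M E) (α : RoughForm E M k) :
    E → E [⋀^Fin k]→L[ℝ] ℝ :=
  fun y => (α (e.symm y)).compContinuousLinearMap (mfderiv 𝓘(ℝ, E) 𝓘(ℝ, E) e.symm y)

/-- `α` is smooth on the open set `W`: it is smooth in every chart of the atlas. -/
def IsSmoothOn {k : ℕ} (α : RoughForm E M k) (W : Set M) : Prop :=
  ∀ e ∈ atlas E M, ContDiffOn ℝ ∞ (localRep e α) (e.target ∩ e.symm ⁻¹' W)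

/-- The exterior derivative, computed at `x` in the preferred chart at `x`: it is
`e^* (d ((e⁻¹)^* α))`. -/
def dForm {k : ℕ} (α : RoughForm E M k) : RoughForm E M (k + 1) :=
  fun x => (extDeriv (localRep (chartAt E x) α) (chartAt E x x)).compContinuousLinearMap
    (mfderiv 𝓘(ℝ, E) 𝓘(ℝ, E) (chartAt E x) x)

/-- `α` is exact on the open set `W`: there is a smooth `(k-1)`-form `ν` on `W` with `dν = α|_W`.
(The values of `ν` outside `W` are irrelevant. In degree `0` the only exact form is zero.) -/
def IsExactOn : {k : ℕ} → RoughForm E M k → Set M → Prop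
  | 0, α, W => ∀ x ∈ W, α x = 0
  | _ + 1, α, W => ∃ ν : RoughForm E M _, IsSmoothOn ν W ∧ ∀ x ∈ W, dForm ν x = α x

section linear

variable {k : ℕ}

lemma localRep_add (e : OpenPartialHomeomorph M E) (α β : RoughForm E M k) :
    localRep e (α + β) = localRep e α + localRep e β := rfl

lemma localRep_smul (e : OpenPartialHomeomorph M E) (c : ℝ) (α : RoughForm E M k) :
    localRep e (c • α) = c • localRep e α := rfl

lemma localRep_zero (e : OpenPartialHomeomorph M E) :
    localRep e (0 : RoughForm E M k) = 0 := rfl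

lemma isSmoothOn_zero (W : Set M) : IsSmoothOn (0 : RoughForm E M k) W :=
  fun e _ => by rw [localRep_zero]; exact contDiffOn_const

lemma IsSmoothOn.add {α β : RoughForm E M k} {W : Set M} (hα : IsSmoothOn α W)
    (hβ : IsSmoothOn β W) : IsSmoothOn (α + β) W :=
  fun e he => by rw [localRep_add]; exact (hα e he).add (hβ e he)

lemma IsSmoothOn.smul (c : ℝ) {α : RoughForm E M k} {W : Set M} (hα : IsSmoothOn α W) :
    IsSmoothOn (c • α) W :=
  fun e he => by rw [localRep_smul]; exact (hα e he).const_smul c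

lemma IsSmoothOn.mono {α : RoughForm E M k} {W W' : Set M} (hα : IsSmoothOn α W)
    (h : W' ⊆ W) : IsSmoothOn α W' :=
  fun e he => (hα e he).mono fun _ hy => ⟨hy.1, h hy.2⟩

lemma IsSmoothOn.differentiableAt {α : RoughForm E M k} {W : Set M} (hα : IsSmoothOn α W)
    (hW : IsOpen W) {x : M} (hx : x ∈ W) :
    DifferentiableAt ℝ (localRep (chartAt E x) α) (chartAt E x x) := by
  have hopen : IsOpen ((chartAt E x).target ∩ (chartAt E x).symm ⁻¹' W) :=
    (chartAt E x).isOpen_inter_preimage_symm hW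
  have hmem : chartAt E x x ∈ (chartAt E x).target ∩ (chartAt E x).symm ⁻¹' W :=
    ⟨mem_chart_target E x, by simpa using hx⟩
  exact ((hα _ (chart_mem_atlas E x)).contDiffAt (hopen.mem_nhds hmem)).differentiableAt
    (by simp)

lemma dForm_zero : dForm (0 : RoughForm E M k) = 0 := by
  funext x
  have h : extDeriv (0 : E → E [⋀^Fin k]→L[ℝ] ℝ) (chartAt E x x) = 0 := by
    simpa using extDeriv_smul (x := chartAt E x x) (0 : ℝ) (0 : E → E [⋀^Fin k]→L[ℝ] ℝ)
  rw [dForm, localRep_zero, h]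
  rfl

lemma dForm_add {α β : RoughForm E M k} {W : Set M} (hW : IsOpen W) (hα : IsSmoothOn α W)
    (hβ : IsSmoothOn β W) {x : M} (hx : x ∈ W) :
    dForm (α + β) x = dForm α x + dForm β x := by
  rw [dForm, localRep_add,
    extDeriv_add (hα.differentiableAt hW hx) (hβ.differentiableAt hW hx)]
  rfl

lemma dForm_smul (c : ℝ) (α : RoughForm E M k) : dForm (c • α) = c • dForm α := by
  funext x
  rw [dForm, localRep_smul, extDeriv_smul]
  rfl

lemma isExactOn_zero (W : Set M) : IsExactOn (0 : RoughForm E M k) W := by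
  cases k with
  | zero => exact fun _ _ => rfl
  | succ k => exact ⟨0, isSmoothOn_zero W, fun x _ => by rw [dForm_zero]⟩

lemma IsExactOn.add {α β : RoughForm E M k} {W : Set M} (hW : IsOpen W)
    (hα : IsExactOn α W) (hβ : IsExactOn β W) : IsExactOn (α + β) W := by
  cases k with
  | zero => exact fun x hx => by rw [RoughForm.add_apply, hα x hx, hβ x hx, add_zero]
  | succ k =>
    obtain ⟨ν, hν, h⟩ := hα
    obtain ⟨ν', hν', h'⟩ := hβ
    exact ⟨ν + ν', hν.add hν', fun x hx => by
      rw [dForm_add hW hν hν' hx, h x hx, h' x hx, RoughForm.add_apply]⟩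

lemma IsExactOn.smul (c : ℝ) {α : RoughForm E M k} {W : Set M} (hα : IsExactOn α W) :
    IsExactOn (c • α) W := by
  cases k with
  | zero => exact fun x hx => by rw [RoughForm.smul_apply, hα x hx, smul_zero]
  | succ k =>
    obtain ⟨ν, hν, h⟩ := hα
    exact ⟨c • ν, hν.smul c, fun x hx => by
      rw [dForm_smul, RoughForm.smul_apply, RoughForm.smul_apply, h x hx]⟩

lemma IsExactOn.mono {α : RoughForm E M k} {W W' : Set M} (hα : IsExactOn α W)
    (h : W' ⊆ W) : IsExactOn α W' := by
  cases k with
  | zero => exact fun x hx => hα x (h hx)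
  | succ k =>
    obtain ⟨ν, hν, h'⟩ := hα
    exact ⟨ν, hν.mono h, fun x hx => h' x (h hx)⟩

end linear

variable (E M)

/-- `Z^k(M)`: the smooth closed `k`-forms. -/
def closedForms (k : ℕ) : Submodule ℝ (RoughForm E M k) where
  carrier := {α | IsSmoothOn α Set.univ ∧ dForm α = 0}
  zero_mem' := ⟨isSmoothOn_zero _, dForm_zero⟩
  add_mem' {α β} hα hβ := ⟨hα.1.add hβ.1, by
    funext x
    rw [dForm_add isOpen_univ hα.1 hβ.1 (Set.mem_univ x), hα.2, hβ.2]
    exact add_zero _⟩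
  smul_mem' c α hα := ⟨hα.1.smul c, by rw [dForm_smul, hα.2, smul_zero]⟩

/-- `B^k(M)`: the exact `k`-forms, `{dν | ν ∈ Ω^{k-1}(M)}`. -/
def exactForms (k : ℕ) : Submodule ℝ (RoughForm E M k) where
  carrier := {α | IsExactOn α Set.univ}
  zero_mem' := isExactOn_zero _
  add_mem' hα hβ := hα.add isOpen_univ hβ
  smul_mem' c _ hα := hα.smul c

/-- The smooth closed `k`-forms that are exact outside a compact set. -/
def closedFormsExactAtInfinity [T2Space M] (k : ℕ) : Submodule ℝ (RoughForm E M k) where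
  carrier := {α | α ∈ closedForms E M k ∧ ∃ K : Set M, IsCompact K ∧ IsExactOn α Kᶜ}
  zero_mem' := ⟨Submodule.zero_mem _, ∅, isCompact_empty, isExactOn_zero _⟩
  add_mem' := by
    rintro α β ⟨hα, K, hK, h⟩ ⟨hβ, L, hL, h'⟩
    refine ⟨Submodule.add_mem _ hα hβ, K ∪ L, hK.union hL, ?_⟩
    exact (h.mono (Set.compl_subset_compl.2 Set.subset_union_left)).add
      (hK.union hL).isClosed.isOpen_compl
      (h'.mono (Set.compl_subset_compl.2 Set.subset_union_right))
  smul_mem' := by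
    rintro c α ⟨hα, K, hK, h⟩
    exact ⟨Submodule.smul_mem _ c hα, K, hK, h.smul c⟩

/-- The quotient of the closed `k`-forms that are exact outside a compact set by the subspace of
exact `k`-forms. -/
abbrev HBar [T2Space M] (k : ℕ) : Type _ :=
  (closedFormsExactAtInfinity E M k) ⧸
    (exactForms E M k).submoduleOf (closedFormsExactAtInfinity E M k)

/-- `c_k(M)`, the real dimension (a cardinal) of this quotient, for a smooth Hausdorff manifold
`M` modelled on `E`. -/
def c [T2Space M] (k : ℕ) : Cardinal := Module.rank ℝ (HBar E M k)

end OpenGenus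

end

/-!
Vanishing of `c₁` passes from `M` to its open subsets `U`. Cutting off a primitive at infinity of a
closed `1`-form `α` on `U` yields an exact form that agrees with `α` outside a compact subset of
`U`; the difference extends by zero to a closed compactly supported form on `M`, hence is exact.

On a sphere of dimension `n ≥ 2` every closed `1`-form is exact: it has primitives on the
complements of two antipodal points, because stereographic projection identifies each complement
with `ℝⁿ`, and these differ by a constant on the intersection, which is connected since `n ≥ 2`.
-/

noncomputable section

namespace OpenGenus

open ContinuousAlternatingMap

section VectorSpace

variable {E F : Type*} [NormedAddCommGroup E] [NormedSpace ℝ E]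
  [NormedAddCommGroup F] [NormedSpace ℝ F]

/-- The identification of `F`-valued `1`-forms at a point, which are alternating maps in one
variable, with continuous linear maps; through it a `1`-form is compared with a derivative. -/
def oneFormEquiv (E F : Type*) [NormedAddCommGroup E] [NormedSpace ℝ E]
    [NormedAddCommGroup F] [NormedSpace ℝ F] :
    (E [⋀^Fin 1]→L[ℝ] F) ≃ₗᵢ[ℝ] (E →L[ℝ] F) :=
  (ofSubsingletonLIE (0 : Fin 1)).symm

lemma fderiv_oneFormEquiv_comp_symmetric {θ : E → E [⋀^Fin 1]→L[ℝ] F} {a : E}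
    (hθ : extDeriv θ a = 0) (u v : E) :
    fderiv ℝ (oneFormEquiv E F ∘ θ) a u v = fderiv ℝ (oneFormEquiv E F ∘ θ) a v u := by
  have remove_zero : (0 : Fin 2).removeNth ![u, v] = fun _ => v := by
    ext i; fin_cases i; rfl
  have remove_one : (1 : Fin 2).removeNth ![u, v] = fun _ => u := by
    ext i; fin_cases i; rfl
  have alternating_sum : fderiv ℝ θ a u (fun _ => v) - fderiv ℝ θ a v (fun _ => u) = 0 := by
    have := DFunLike.congr_fun hθ ![u, v]
    rwa [extDeriv, alternatizeUncurryFin_apply, Fin.sum_univ_two, remove_zero, remove_one,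
      Fin.val_zero, pow_zero, one_smul, Fin.val_one, pow_one, neg_one_smul,
      ← sub_eq_add_neg] at this
  rw [LinearIsometryEquiv.comp_fderiv]
  exact sub_eq_zero.1 alternating_sum

lemma exists_hasFDerivAt_of_extDeriv_eq_zero [CompleteSpace F] {θ : E → E [⋀^Fin 1]→L[ℝ] F}
    {s : Set E} (hs : Convex ℝ s) (hso : IsOpen s) (hθ : ContDiffOn ℝ ∞ θ s)
    (hdθ : ∀ a ∈ s, extDeriv θ a = 0) :
    ∃ f : E → F, ∀ a ∈ s, ContDiffAt ℝ ∞ f a ∧ HasFDerivAt f (oneFormEquiv E F (θ a)) a := by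
  have hθ' : ContDiffOn ℝ ∞ (oneFormEquiv E F ∘ θ) s :=
    (oneFormEquiv E F).contDiff.comp_contDiffOn hθ
  obtain ⟨f, hf⟩ := hs.exists_forall_hasFDerivAt_of_fderiv_symmetric hso
    (hθ'.differentiableOn (by simp))
    fun a ha => fderiv_oneFormEquiv_comp_symmetric (hdθ a ha)
  have hf_smooth : ContDiffOn ℝ ∞ f s :=
    (contDiffOn_infty_iff_fderiv_of_isOpen hso).2
      ⟨fun a ha => (hf a ha).differentiableAt.differentiableWithinAt,
        hθ'.congr fun a ha => (hf a ha).fderiv⟩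
  exact ⟨f, fun a ha => ⟨hf_smooth.contDiffAt (hso.mem_nhds ha), hf a ha⟩⟩

lemma extDeriv_oneFormEquiv_symm_fderiv {f : E → F} {a : E} (hf : ContDiffAt ℝ ∞ f a) :
    extDeriv (fun y => (oneFormEquiv E F).symm (fderiv ℝ f y)) a = 0 := by
  have d_zeroForm : extDeriv (fun y => constOfIsEmpty ℝ E (Fin 0) (f y)) =
      fun y => (oneFormEquiv E F).symm (fderiv ℝ f y) :=
    funext fun y => extDeriv_constOfIsEmpty f y
  rw [← d_zeroForm]
  exact extDeriv_extDeriv_apply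
    ((constOfIsEmptyLIE ℝ E F (Fin 0)).contDiff.contDiffAt.comp a hf)
    (by rw [minSmoothness_of_isRCLikeNormedField]; exact ENat.LEInfty.out)

end VectorSpace

section Charts

variable {E : Type*} [NormedAddCommGroup E] [NormedSpace ℝ E]
  {M : Type*} [TopologicalSpace M] [ChartedSpace E M]
  {e e' : OpenPartialHomeomorph M E} {k : ℕ}

lemma mfderiv_symm_eq_comp_fderiv [IsManifold 𝓘(ℝ, E) 1 M] (he : e ∈ atlas E M)
    (he' : e' ∈ atlas E M) {y : E} (hy : y ∈ e.target) (hy' : e.symm y ∈ e'.source) :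
    (mfderiv 𝓘(ℝ, E) 𝓘(ℝ, E) e.symm y : E →L[ℝ] E) =
      (mfderiv 𝓘(ℝ, E) 𝓘(ℝ, E) e'.symm (e' (e.symm y)) : E →L[ℝ] E) ∘L
        fderiv ℝ (e' ∘ e.symm) y := by
  have hde := mdifferentiable_of_mem_atlas (I := 𝓘(ℝ, E)) he
  have hde' := mdifferentiable_of_mem_atlas (I := 𝓘(ℝ, E)) he'
  have transition : HasMFDerivAt 𝓘(ℝ, E) 𝓘(ℝ, E) (e' ∘ e.symm) y
      (fderiv ℝ (e' ∘ e.symm) y) :=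
    (((hde'.mdifferentiableAt hy').comp y
      (hde.mdifferentiableAt_symm hy)).differentiableAt).hasFDerivAt.hasMFDerivAt
  have symm_eventuallyEq : e.symm =ᶠ[𝓝 y] e'.symm ∘ (e' ∘ e.symm) := by
    filter_upwards [(e.isOpen_inter_preimage_symm e'.open_source).mem_nhds ⟨hy, hy'⟩] with z hz
    exact (e'.left_inv hz.2).symm
  exact (((hde'.mdifferentiableAt_symm (e'.map_source hy')).hasMFDerivAt.comp y
    transition).congr_of_eventuallyEq symm_eventuallyEq).mfderiv

lemma localRep_eq_compContinuousLinearMap [IsManifold 𝓘(ℝ, E) 1 M] (α : RoughForm E M k)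
    (he : e ∈ atlas E M) (he' : e' ∈ atlas E M) {y : E} (hy : y ∈ e.target)
    (hy' : e.symm y ∈ e'.source) :
    localRep e α y = (localRep e' α ((e' ∘ e.symm) y)).compContinuousLinearMap
      (fderiv ℝ (e' ∘ e.symm) y) := by
  unfold localRep
  rw [mfderiv_symm_eq_comp_fderiv he he' hy hy', Function.comp_apply, e'.left_inv hy']
  rfl

lemma compContinuousLinearMap_localRep [IsManifold 𝓘(ℝ, E) 1 M] (α : RoughForm E M k)
    (he : e ∈ atlas E M) {x : M} (hx : x ∈ e.source) :
    (localRep e α (e x)).compContinuousLinearMap (mfderiv 𝓘(ℝ, E) 𝓘(ℝ, E) e x) = α x := by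
  have symm_comp : (mfderiv 𝓘(ℝ, E) 𝓘(ℝ, E) e.symm (e x) : E →L[ℝ] E) ∘L
      (mfderiv 𝓘(ℝ, E) 𝓘(ℝ, E) e x : E →L[ℝ] E) = ContinuousLinearMap.id ℝ E :=
    (mdifferentiable_of_mem_atlas he).symm_comp_deriv hx
  calc (localRep e α (e x)).compContinuousLinearMap (mfderiv 𝓘(ℝ, E) 𝓘(ℝ, E) e x)
      = (α (e.symm (e x)) : E [⋀^Fin k]→L[ℝ] ℝ).compContinuousLinearMap
          ((mfderiv 𝓘(ℝ, E) 𝓘(ℝ, E) e.symm (e x) : E →L[ℝ] E) ∘L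
            (mfderiv 𝓘(ℝ, E) 𝓘(ℝ, E) e x : E →L[ℝ] E)) := rfl
    _ = α x := by rw [symm_comp, e.left_inv hx]; rfl

variable [IsManifold 𝓘(ℝ, E) ∞ M]

lemma contDiffAt_comp_symm (he : e ∈ atlas E M) (he' : e' ∈ atlas E M) {y : E}
    (hy : y ∈ e.target) (hy' : e.symm y ∈ e'.source) : ContDiffAt ℝ ∞ (e' ∘ e.symm) y :=
  contMDiffAt_iff_contDiffAt.1 <|
    (contMDiffAt_of_mem_maximalAtlas (IsManifold.subset_maximalAtlas he') hy').comp y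
      (contMDiffAt_symm_of_mem_maximalAtlas (IsManifold.subset_maximalAtlas he) hy)

lemma contMDiffAt_iff_comp_symm {F : Type*} [NormedAddCommGroup F] [NormedSpace ℝ F] {f : M → F}
    (he : e ∈ atlas E M) {x : M} (hx : x ∈ e.source) :
    ContMDiffAt 𝓘(ℝ, E) 𝓘(ℝ, F) ∞ f x ↔ ContDiffAt ℝ ∞ (f ∘ e.symm) (e x) := by
  have he_max := IsManifold.subset_maximalAtlas (I := 𝓘(ℝ, E)) (n := ∞) he
  rw [← contMDiffAt_iff_contDiffAt]
  refine ⟨fun h => ?_, fun h => ?_⟩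
  · exact ContMDiffAt.comp (e x) (by rwa [e.left_inv hx])
      (contMDiffAt_symm_of_mem_maximalAtlas he_max (e.map_source hx))
  · refine (h.comp x (contMDiffAt_of_mem_maximalAtlas he_max hx)).congr_of_eventuallyEq ?_
    filter_upwards [e.open_source.mem_nhds hx] with z hz
    exact congrArg f (e.left_inv hz).symm

lemma extDeriv_localRep {α : RoughForm E M k} {W : Set M} (hW : IsOpen W)
    (hα : IsSmoothOn α W) (he : e ∈ atlas E M) {y : E} (hy : y ∈ e.target)
    (hyW : e.symm y ∈ W) : extDeriv (localRep e α) y = localRep e (dForm α) y := by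
  set e' := chartAt E (e.symm y)
  have he' : e' ∈ atlas E M := chart_mem_atlas E _
  have hy' : e.symm y ∈ e'.source := mem_chart_source E _
  have chart_change : localRep e α =ᶠ[𝓝 y] fun z =>
      (localRep e' α ((e' ∘ e.symm) z)).compContinuousLinearMap
        (fderiv ℝ (e' ∘ e.symm) z) := by
    filter_upwards [(e.isOpen_inter_preimage_symm e'.open_source).mem_nhds ⟨hy, hy'⟩] with z hz
    exact localRep_eq_compContinuousLinearMap α he he' hz.1 hz.2
  have chain_rule : fderiv ℝ (e' ∘ e.symm) y =
      (mfderiv 𝓘(ℝ, E) 𝓘(ℝ, E) e' (e.symm y) : E →L[ℝ] E) ∘L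
        (mfderiv 𝓘(ℝ, E) 𝓘(ℝ, E) e.symm y : E →L[ℝ] E) :=
    mfderiv_eq_fderiv.symm.trans <| mfderiv_comp y
      ((mdifferentiable_of_mem_atlas he').mdifferentiableAt hy')
      ((mdifferentiable_of_mem_atlas he).mdifferentiableAt_symm hy)
  have hα' : DifferentiableAt ℝ (localRep e' α) ((e' ∘ e.symm) y) := hα.differentiableAt hW hyW
  rw [chart_change.extDeriv_eq, extDeriv_pullback hα' (contDiffAt_comp_symm he he' hy hy')
    (by rw [minSmoothness_of_isRCLikeNormedField]; exact ENat.LEInfty.out), chain_rule]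
  rfl

end Charts

section Primitives

variable {E : Type*} [NormedAddCommGroup E] [NormedSpace ℝ E]
  {M : Type*} [TopologicalSpace M] [ChartedSpace E M]

/-- The function `f` is a primitive of the `1`-form `α` at the point `x`: it is smooth at `x` and
`df = α` there. The condition on `df` concerns the single point `x` only. -/
def IsPrimitiveAt (f : M → ℝ) (α : RoughForm E M 1) (x : M) : Prop :=
  ContMDiffAt 𝓘(ℝ, E) 𝓘(ℝ, ℝ) ∞ f x ∧
    HasMFDerivAt 𝓘(ℝ, E) 𝓘(ℝ, ℝ) f x (oneFormEquiv E ℝ (α x))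

section Algebra

variable {f g : M → ℝ} {α β : RoughForm E M 1} {x : M}

lemma IsPrimitiveAt.congr (h : IsPrimitiveAt f α x) (hfg : g =ᶠ[𝓝 x] f) :
    IsPrimitiveAt g α x :=
  ⟨h.1.congr_of_eventuallyEq hfg, h.2.congr_of_eventuallyEq hfg⟩

lemma IsPrimitiveAt.congr_form (h : IsPrimitiveAt f α x) (hαβ : β x = α x) :
    IsPrimitiveAt f β x :=
  ⟨h.1, hαβ ▸ h.2⟩

lemma IsPrimitiveAt.form_unique (hα : IsPrimitiveAt f α x) (hβ : IsPrimitiveAt f β x) :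
    α x = β x :=
  (oneFormEquiv E ℝ).injective (hasMFDerivAt_unique hα.2 hβ.2)

lemma IsPrimitiveAt.add (hf : IsPrimitiveAt f α x) (hg : IsPrimitiveAt g β x) :
    IsPrimitiveAt (f + g) (α + β) x :=
  ⟨hf.1.add hg.1, hf.2.add hg.2⟩

lemma IsPrimitiveAt.sub (hf : IsPrimitiveAt f α x) (hg : IsPrimitiveAt g β x) :
    IsPrimitiveAt (f - g) (α - β) x :=
  ⟨hf.1.sub hg.1, hf.2.sub hg.2⟩

lemma isPrimitiveAt_const (a : ℝ) (x : M) :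
    IsPrimitiveAt (fun _ => a) (0 : RoughForm E M 1) x :=
  ⟨contMDiffAt_const, hasMFDerivAt_const a x⟩

lemma IsPrimitiveAt.add_const (h : IsPrimitiveAt f α x) (a : ℝ) :
    IsPrimitiveAt (fun z => f z + a) α x :=
  (h.add (isPrimitiveAt_const a x)).congr_form (add_zero (α x)).symm

end Algebra

/-- A function regarded as a `0`-form. -/
def RoughForm.ofFunction (f : M → ℝ) : RoughForm E M 0 :=
  fun x => constOfIsEmpty ℝ E (Fin 0) (f x)

lemma RoughForm.ofFunction_apply_zero (ν : RoughForm E M 0) :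
    RoughForm.ofFunction (fun x => ν x 0) = ν := by
  funext x
  ext v
  exact congrArg (ν x) (Subsingleton.elim _ _)

variable [IsManifold 𝓘(ℝ, E) ∞ M] {e : OpenPartialHomeomorph M E} {f : M → ℝ}
  {α : RoughForm E M 1}

lemma isSmoothOn_ofFunction_iff {W : Set M} (hW : IsOpen W) :
    IsSmoothOn (RoughForm.ofFunction (E := E) f) W ↔
      ∀ x ∈ W, ContMDiffAt 𝓘(ℝ, E) 𝓘(ℝ, ℝ) ∞ f x := by
  have smooth_in_chart (e : OpenPartialHomeomorph M E) :
      ContDiffOn ℝ ∞ (localRep e (RoughForm.ofFunction f)) (e.target ∩ e.symm ⁻¹' W) ↔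
        ContDiffOn ℝ ∞ (f ∘ e.symm) (e.target ∩ e.symm ⁻¹' W) :=
    (constOfIsEmptyLIE ℝ E ℝ (Fin 0)).toContinuousLinearEquiv.comp_contDiffOn_iff
  refine ⟨fun h x hx => ?_, fun h e he => (smooth_in_chart e).2 fun y hy => ?_⟩
  · have hx' := mem_chart_source E x
    rw [contMDiffAt_iff_comp_symm (chart_mem_atlas E x) hx']
    exact ((smooth_in_chart _).1 (h _ (chart_mem_atlas E x))).contDiffAt <|
      ((chartAt E x).isOpen_inter_preimage_symm hW).mem_nhds
        ⟨mem_chart_target E x, by rwa [Set.mem_preimage, (chartAt E x).left_inv hx']⟩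
  · have := (contMDiffAt_iff_comp_symm he (e.map_target hy.1)).1 (h _ hy.2)
    rw [e.right_inv hy.1] at this
    exact this.contDiffWithinAt

lemma IsPrimitiveAt.comp_symm (he : e ∈ atlas E M) {y : E} (hy : y ∈ e.target)
    (h : IsPrimitiveAt f α (e.symm y)) :
    ContDiffAt ℝ ∞ (f ∘ e.symm) y ∧
      HasFDerivAt (f ∘ e.symm) (oneFormEquiv E ℝ (localRep e α y)) y := by
  constructor
  · have := (contMDiffAt_iff_comp_symm he (e.map_target hy)).1 h.1
    rwa [e.right_inv hy] at this
  · exact hasMFDerivAt_iff_hasFDerivAt.1 (h.2.comp y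
      ((mdifferentiable_of_mem_atlas he).mdifferentiableAt_symm hy).hasMFDerivAt)

lemma isPrimitiveAt_dForm_ofFunction {x : M} (hf : ContMDiffAt 𝓘(ℝ, E) 𝓘(ℝ, ℝ) ∞ f x) :
    IsPrimitiveAt f (dForm (RoughForm.ofFunction (E := E) f)) x := by
  set e := chartAt E x
  have he : e ∈ atlas E M := chart_mem_atlas E x
  have hx : x ∈ e.source := mem_chart_source E x
  have differentiable_in_chart : DifferentiableAt ℝ (f ∘ e.symm) (e x) :=
    ((contMDiffAt_iff_comp_symm he hx).1 hf).differentiableAt (by simp)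
  have dForm_in_chart : oneFormEquiv E ℝ (dForm (RoughForm.ofFunction (E := E) f) x) =
      fderiv ℝ (f ∘ e.symm) (e x) ∘L (mfderiv 𝓘(ℝ, E) 𝓘(ℝ, E) e x : E →L[ℝ] E) := by
    ext v
    exact DFunLike.congr_fun (extDeriv_constOfIsEmpty (𝕜 := ℝ) (f ∘ e.symm) (e x))
      fun _ => mfderiv 𝓘(ℝ, E) 𝓘(ℝ, E) e x v
  refine ⟨hf, ?_⟩
  rw [dForm_in_chart]
  refine (differentiable_in_chart.hasFDerivAt.hasMFDerivAt.comp x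
    ((mdifferentiable_of_mem_atlas he).mdifferentiableAt hx).hasMFDerivAt).congr_of_eventuallyEq ?_
  filter_upwards [e.open_source.mem_nhds hx] with z hz
  exact congrArg f (e.left_inv hz).symm

lemma isExactOn_iff_exists_isPrimitiveAt {W : Set M} (hW : IsOpen W) :
    IsExactOn α W ↔ ∃ f : M → ℝ, ∀ x ∈ W, IsPrimitiveAt f α x := by
  constructor
  · rintro ⟨ν, hν, hdν⟩
    rw [← ν.ofFunction_apply_zero] at hν hdν
    exact ⟨fun x => ν x 0, fun x hx => (isPrimitiveAt_dForm_ofFunction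
      ((isSmoothOn_ofFunction_iff hW).1 hν x hx)).congr_form (hdν x hx).symm⟩
  · rintro ⟨f, hf⟩
    exact ⟨RoughForm.ofFunction f, (isSmoothOn_ofFunction_iff hW).2 fun x hx => (hf x hx).1,
      fun x hx => (isPrimitiveAt_dForm_ofFunction (hf x hx).1).form_unique (hf x hx)⟩

lemma mem_exactForms_one_iff :
    α ∈ exactForms E M 1 ↔ ∃ f : M → ℝ, ∀ x, IsPrimitiveAt f α x :=
  (isExactOn_iff_exists_isPrimitiveAt isOpen_univ).trans <| by
    simp only [Set.mem_univ, forall_const]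

lemma isPrimitiveAt_comp_chart (he : e ∈ atlas E M) {x : M} (hx : x ∈ e.source) {f : E → ℝ}
    (hf : ContDiffAt ℝ ∞ f (e x))
    (hdf : HasFDerivAt f (oneFormEquiv E ℝ (localRep e α (e x))) (e x)) :
    IsPrimitiveAt (f ∘ e) α x := by
  refine ⟨hf.contMDiffAt.comp x (contMDiffAt_of_mem_maximalAtlas
    (IsManifold.subset_maximalAtlas he) hx), ?_⟩
  rw [← compContinuousLinearMap_localRep α he hx]
  exact hdf.hasMFDerivAt.comp x
    ((mdifferentiable_of_mem_atlas he).mdifferentiableAt hx).hasMFDerivAt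

lemma exists_isPrimitiveAt_of_convex (hα : α ∈ closedForms E M 1) (he : e ∈ atlas E M)
    {s : Set E} (hs : Convex ℝ s) (hso : IsOpen s) (hse : s ⊆ e.target) :
    ∃ f : M → ℝ, ∀ x ∈ e.source ∩ e ⁻¹' s, IsPrimitiveAt f α x := by
  have closed_in_chart : ∀ y ∈ s, extDeriv (localRep e α) y = 0 := fun y hy => by
    rw [extDeriv_localRep isOpen_univ hα.1 he (hse hy) trivial, hα.2, localRep_zero, Pi.zero_apply]
  obtain ⟨f, hf⟩ := exists_hasFDerivAt_of_extDeriv_eq_zero hs hso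
    ((hα.1 e he).mono fun y hy => ⟨hse hy, trivial⟩) closed_in_chart
  exact ⟨f ∘ e, fun x hx => isPrimitiveAt_comp_chart he hx.1 (hf _ hx.2).1 (hf _ hx.2).2⟩

lemma mem_closedForms_of_forall_eventually_isPrimitiveAt
    (h : ∀ x, ∃ f : M → ℝ, ∀ᶠ z in 𝓝 x, IsPrimitiveAt f α z) : α ∈ closedForms E M 1 := by
  have locally_df : ∀ e ∈ atlas E M, ∀ y ∈ e.target, ∃ g : E → ℝ, ContDiffAt ℝ ∞ g y ∧
      localRep e α =ᶠ[𝓝 y] fun z => (oneFormEquiv E ℝ).symm (fderiv ℝ g z) := by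
    intro e he y hy
    obtain ⟨f, hf⟩ := h (e.symm y)
    have hf' := (e.continuousAt_symm hy).eventually hf
    refine ⟨f ∘ e.symm, (hf'.self_of_nhds.comp_symm he hy).1, ?_⟩
    filter_upwards [hf', e.open_target.mem_nhds hy] with z hz hz_target
    rw [(hz.comp_symm he hz_target).2.fderiv, LinearIsometryEquiv.symm_apply_apply]
  constructor
  · intro e he y hy
    obtain ⟨g, hg, hαg⟩ := locally_df e he y hy.1
    exact (((oneFormEquiv E ℝ).symm.contDiff.contDiffAt.comp y
      (hg.fderiv_right le_rfl)).congr_of_eventuallyEq hαg).contDiffWithinAt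
  · funext x
    obtain ⟨g, hg, hαg⟩ := locally_df _ (chart_mem_atlas E x) _ (mem_chart_target E x)
    rw [dForm, hαg.extDeriv_eq, extDeriv_oneFormEquiv_symm_fderiv hg]
    rfl

lemma mem_closedForms_iff_forall_eventually_isPrimitiveAt :
    α ∈ closedForms E M 1 ↔ ∀ x, ∃ f : M → ℝ, ∀ᶠ z in 𝓝 x, IsPrimitiveAt f α z := by
  refine ⟨fun hα x => ?_, mem_closedForms_of_forall_eventually_isPrimitiveAt⟩
  obtain ⟨r, hr, hball⟩ :=
    Metric.isOpen_iff.1 (chartAt E x).open_target _ (mem_chart_target E x)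
  obtain ⟨f, hf⟩ := exists_isPrimitiveAt_of_convex hα (chart_mem_atlas E x)
    (convex_ball _ r) Metric.isOpen_ball hball
  exact ⟨f, Filter.eventually_of_mem (((chartAt E x).isOpen_inter_preimage
    Metric.isOpen_ball).mem_nhds ⟨mem_chart_source E x, Metric.mem_ball_self hr⟩) hf⟩

lemma exactForms_one_le_closedForms_one : exactForms E M 1 ≤ closedForms E M 1 := fun α hα => by
  obtain ⟨f, hf⟩ := mem_exactForms_one_iff.1 hα
  exact mem_closedForms_of_forall_eventually_isPrimitiveAt fun _ =>
    ⟨f, Filter.Eventually.of_forall hf⟩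

end Primitives

section MayerVietoris

variable {E : Type*} [NormedAddCommGroup E] [NormedSpace ℝ E]
  {F : Type*} [NormedAddCommGroup F] [NormedSpace ℝ F]
  {M : Type*} [TopologicalSpace M] [ChartedSpace E M]
  {V W : Set M}

lemma eventually_eq_of_hasMFDerivAt_zero [IsManifold 𝓘(ℝ, E) 1 M] {f : M → F} (hW : IsOpen W)
    (hf : ∀ x ∈ W, HasMFDerivAt 𝓘(ℝ, E) 𝓘(ℝ, F) f x (0 : E →L[ℝ] F)) {x : M} (hx : x ∈ W) :
    ∀ᶠ z in 𝓝 x, f z = f x := by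
  set e := chartAt E x
  have hxe : x ∈ e.source := mem_chart_source E x
  obtain ⟨r, hr, hball⟩ := Metric.isOpen_iff.1 (e.isOpen_inter_preimage_symm hW) (e x)
    ⟨e.map_source hxe, by rwa [Set.mem_preimage, e.left_inv hxe]⟩
  have derivative_zero : ∀ y ∈ Metric.ball (e x) r,
      HasFDerivAt (f ∘ e.symm) (0 : E →L[ℝ] F) y := fun y hy =>
    hasMFDerivAt_iff_hasFDerivAt.1 <| ((hf _ (hball hy).2).comp y
      (((mdifferentiable_of_mem_atlas (chart_mem_atlas E x)).mdifferentiableAt_symm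
        (hball hy).1).hasMFDerivAt)).congr_mfderiv (ContinuousLinearMap.zero_comp _)
  filter_upwards [(e.isOpen_inter_preimage Metric.isOpen_ball).mem_nhds
    ⟨hxe, Metric.mem_ball_self hr⟩] with z ⟨hze, hz⟩
  have := Metric.isOpen_ball.is_const_of_fderiv_eq_zero (convex_ball (e x) r).isPreconnected
    (fun y hy => (derivative_zero y hy).differentiableAt.differentiableWithinAt)
    (fun y hy => (derivative_zero y hy).fderiv) hz (Metric.mem_ball_self hr)
  rwa [Function.comp_apply, Function.comp_apply, e.left_inv hze, e.left_inv hxe] at this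

lemma eq_of_hasMFDerivAt_zero [IsManifold 𝓘(ℝ, E) 1 M] {f : M → F} (hW : IsOpen W)
    (hWc : IsPreconnected W)
    (hf : ∀ x ∈ W, HasMFDerivAt 𝓘(ℝ, E) 𝓘(ℝ, F) f x (0 : E →L[ℝ] F)) {x y : M} (hx : x ∈ W)
    (hy : y ∈ W) : f x = f y := by
  have := isPreconnected_iff_preconnectedSpace.1 hWc
  have locally_constant : IsLocallyConstant (W.domRestrict f) :=
    (IsLocallyConstant.iff_eventually_eq _).2 fun z =>
      continuous_subtype_val.continuousAt.eventually
        (eventually_eq_of_hasMFDerivAt_zero hW hf z.2)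
  exact locally_constant.apply_eq_of_preconnectedSpace ⟨x, hx⟩ ⟨y, hy⟩

lemma IsExactOn.union [IsManifold 𝓘(ℝ, E) ∞ M] {α : RoughForm E M 1} (hV : IsOpen V)
    (hW : IsOpen W) (hVW : IsPreconnected (V ∩ W)) (hαV : IsExactOn α V) (hαW : IsExactOn α W) :
    IsExactOn α (V ∪ W) := by
  classical
  obtain ⟨f, hf⟩ := (isExactOn_iff_exists_isPrimitiveAt hV).1 hαV
  obtain ⟨g, hg⟩ := (isExactOn_iff_exists_isPrimitiveAt hW).1 hαW
  obtain ⟨a, ha⟩ : ∃ a, ∀ x ∈ V ∩ W, g x + a = f x := by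
    obtain hVW_empty | ⟨x₀, hx₀⟩ := (V ∩ W).eq_empty_or_nonempty
    · exact ⟨0, by simp [hVW_empty]⟩
    refine ⟨(f - g) x₀, fun x hx => ?_⟩
    have difference_const : (f - g) x = (f - g) x₀ :=
      eq_of_hasMFDerivAt_zero (hV.inter hW) hVW (fun z hz =>
        (((hf z hz.1).sub (hg z hz.2)).congr_form (β := 0) (sub_self (α z)).symm).2) hx hx₀
    rw [← difference_const, Pi.sub_apply, add_sub_cancel]
  refine (isExactOn_iff_exists_isPrimitiveAt (hV.union hW)).2
    ⟨V.piecewise f (fun x => g x + a), fun x hx => ?_⟩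
  by_cases hxV : x ∈ V
  · exact (hf x hxV).congr (Filter.eventually_of_mem (hV.mem_nhds hxV)
      (V.piecewise_eqOn f _))
  · have hxW := hx.resolve_left hxV
    refine ((hg x hxW).add_const a).congr ?_
    filter_upwards [hW.mem_nhds hxW] with z hzW
    by_cases hzV : z ∈ V
    · rw [V.piecewise_eq_of_mem _ _ hzV, ha z ⟨hzV, hzW⟩]
    · rw [V.piecewise_eq_of_notMem _ _ hzV]

end MayerVietoris

lemma c_eq_zero_iff {E : Type*} [NormedAddCommGroup E] [NormedSpace ℝ E]
    {M : Type*} [TopologicalSpace M] [ChartedSpace E M] [T2Space M] {k : ℕ} :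
    c E M k = 0 ↔ closedFormsExactAtInfinity E M k ≤ exactForms E M k := by
  rw [c, rank_zero_iff, Submodule.Quotient.subsingleton_iff, Submodule.submoduleOf_eq_top]

section Sphere

variable {F : Type*} [NormedAddCommGroup F] [InnerProductSpace ℝ F] {n : ℕ}
  [Fact (Module.finrank ℝ F = n + 1)]

lemma isPreconnected_sphere_compl_pair (hn : 2 ≤ n) {v w : Metric.sphere (0 : F) 1} (hwv : w ≠ v) :
    IsPreconnected ({v}ᶜ ∩ {w}ᶜ : Set (Metric.sphere (0 : F) 1)) := by
  set e := stereographic' n v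
  have he_source : e.source = {v}ᶜ := stereographic'_source v
  have he_target : e.target = Set.univ := stereographic'_target v
  have hw : w ∈ e.source := by rwa [he_source]
  have image_symm : e.symm '' {e w}ᶜ = ({v}ᶜ ∩ {w}ᶜ : Set (Metric.sphere (0 : F) 1)) := by
    rw [e.symm_image_eq_source_inter_preimage (by rw [he_target]; exact Set.subset_univ _),
      ← he_source]
    ext x
    exact and_congr_right fun hx => not_congr (e.injOn.eq_iff hx hw)
  rw [← image_symm]
  refine (isConnected_compl_singleton_of_one_lt_rank ?_ _).isPreconnected.image _
    (e.continuousOn_symm.mono (by rw [he_target]; exact Set.subset_univ _))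
  rw [← Module.finrank_eq_rank, finrank_euclideanSpace_fin]
  exact_mod_cast hn

lemma isExactOn_sphere_compl_singleton
    {α : RoughForm (EuclideanSpace ℝ (Fin n)) (Metric.sphere (0 : F) 1) 1}
    (hα : α ∈ closedForms (EuclideanSpace ℝ (Fin n)) (Metric.sphere (0 : F) 1) 1)
    (v : Metric.sphere (0 : F) 1) : IsExactOn α {v}ᶜ := by
  have := exists_isPrimitiveAt_of_convex hα (e := stereographic' n v) ⟨v, rfl⟩
    convex_univ isOpen_univ (stereographic'_target v).superset
  rwa [Set.preimage_univ, Set.inter_univ, stereographic'_source,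
    ← isExactOn_iff_exists_isPrimitiveAt isOpen_compl_singleton] at this

lemma closedForms_one_le_exactForms_one_sphere (hn : 2 ≤ n) :
    closedForms (EuclideanSpace ℝ (Fin n)) (Metric.sphere (0 : F) 1) 1 ≤
      exactForms (EuclideanSpace ℝ (Fin n)) (Metric.sphere (0 : F) 1) 1 := by
  have : Nontrivial F := Module.nontrivial_of_finrank_pos (R := ℝ)
    (by rw [(Fact.out : Module.finrank ℝ F = n + 1)]; omega)
  intro α hα
  obtain ⟨v, hv⟩ : (Metric.sphere (0 : F) 1).Nonempty := NormedSpace.sphere_nonempty.2 zero_le_one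
  let v : Metric.sphere (0 : F) 1 := ⟨v, hv⟩
  have hv_neg : v ≠ -v := ne_neg_of_mem_unit_sphere ℝ v
  have cover : ({v}ᶜ ∪ {-v}ᶜ : Set (Metric.sphere (0 : F) 1)) = Set.univ := by
    rw [← Set.compl_inter, (Set.disjoint_singleton.2 hv_neg).inter_eq, Set.compl_empty]
  have := (isExactOn_sphere_compl_singleton hα v).union isOpen_compl_singleton
    isOpen_compl_singleton (isPreconnected_sphere_compl_pair hn hv_neg.symm)
    (isExactOn_sphere_compl_singleton hα (-v))
  rwa [cover] at this

end Sphere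

section Cutoff

variable {E : Type*} [NormedAddCommGroup E] [NormedSpace ℝ E] [FiniteDimensional ℝ E]
  {M : Type*} [TopologicalSpace M] [ChartedSpace E M] [IsManifold 𝓘(ℝ, E) ∞ M]
  [T2Space M] [SigmaCompactSpace M]

lemma exists_mem_exactForms_eq_off_compact {α : RoughForm E M 1} {K : Set M} (hK : IsCompact K)
    (hα : IsExactOn α Kᶜ) :
    ∃ η ∈ exactForms E M 1, ∃ L : Set M, IsCompact L ∧ ∀ x ∉ L, η x = α x := by
  have : LocallyCompactSpace M := ChartedSpace.locallyCompactSpace E M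
  obtain ⟨f, hf⟩ := (isExactOn_iff_exists_isPrimitiveAt hK.isClosed.isOpen_compl).1 hα
  obtain ⟨L, hL, hKL⟩ := exists_compact_superset hK
  obtain ⟨χ, hχ_one, hχ_zero, -⟩ := exists_contMDiffMap_one_nhds_of_subset_interior (n := ⊤)
    𝓘(ℝ, E) hK.isClosed hKL
  let g : M → ℝ := fun x => (1 - χ x) * f x
  have g_smooth (x : M) : ContMDiffAt 𝓘(ℝ, E) 𝓘(ℝ, ℝ) ∞ g x := by
    by_cases hx : x ∈ K
    · refine (contMDiffAt_const (c := (0 : ℝ))).congr_of_eventuallyEq ?_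
      filter_upwards [eventually_nhdsSet_iff_forall.1 hχ_one x hx] with z hz
      simp only [g, hz, sub_self, zero_mul]
    · exact (contMDiffAt_const.sub χ.contMDiff.contMDiffAt).mul (hf x hx).1
  refine ⟨dForm (RoughForm.ofFunction g),
    mem_exactForms_one_iff.2 ⟨g, fun x => isPrimitiveAt_dForm_ofFunction (g_smooth x)⟩,
    L, hL, fun x hx => (isPrimitiveAt_dForm_ofFunction (g_smooth x)).form_unique ?_⟩
  refine (hf x fun hxK => hx (interior_subset (hKL hxK))).congr ?_
  filter_upwards [hL.isClosed.isOpen_compl.mem_nhds hx] with z hz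
  simp only [g, hχ_zero z hz, sub_zero, one_mul]

end Cutoff

section OpenSubset

variable {E : Type*} [NormedAddCommGroup E] [NormedSpace ℝ E]
  {M : Type*} [TopologicalSpace M] [ChartedSpace E M] {U : TopologicalSpace.Opens M} {k : ℕ}

lemma hasMFDerivAt_subtype_val (x : U) :
    HasMFDerivAt 𝓘(ℝ, E) 𝓘(ℝ, E) (Subtype.val : U → M) x (ContinuousLinearMap.id ℝ E) := by
  refine ⟨continuous_subtype_val.continuousAt, ?_⟩
  have identity_in_charts : writtenInExtChartAt 𝓘(ℝ, E) 𝓘(ℝ, E) x (Subtype.val : U → M)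
      =ᶠ[𝓝 (chartAt E x.val x.val)] id := by
    filter_upwards [TopologicalSpace.Opens.chartAt_subtype_val_symm_eventuallyEq (H := E) U
      (x := x), (chartAt E x.val).open_target.mem_nhds (mem_chart_target E x.val)]
      with y hy hy_target
    exact (congrArg (chartAt E x.val) hy).symm.trans ((chartAt E x.val).right_inv hy_target)
  exact ((hasFDerivAt_id _).congr_of_eventuallyEq identity_in_charts).hasFDerivWithinAt

open scoped Classical in
/-- The extension by zero to `M` of a form on an open subset `U`. The tangent spaces of `U` and `M`
at a point of `U` are both the model space `E`, so that no transport is needed. -/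
def RoughForm.extendByZero (β : RoughForm E U k) : RoughForm E M k :=
  fun x => if hx : x ∈ U then (β ⟨x, hx⟩ : E [⋀^Fin k]→L[ℝ] ℝ) else 0

@[simp] lemma RoughForm.extendByZero_coe (β : RoughForm E U k) (x : U) :
    β.extendByZero (x : M) = β x :=
  dif_pos x.2

lemma RoughForm.extendByZero_eq_zero {β : RoughForm E U k} {L : Set U} (hβ : ∀ x ∉ L, β x = 0)
    {x : M} (hx : x ∉ Subtype.val '' L) : β.extendByZero x = 0 := by
  by_cases hxU : x ∈ U
  · lift x to U using hxU
    rw [extendByZero_coe]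
    exact hβ x fun hxL => hx (Set.mem_image_of_mem _ hxL)
  · exact dif_neg hxU

lemma isPrimitiveAt_comp_val_iff {f : M → ℝ} {β : RoughForm E U 1} {x : U} :
    IsPrimitiveAt (f ∘ Subtype.val) β x ↔ IsPrimitiveAt f β.extendByZero (x : M) := by
  have smooth_iff : ContMDiffAt 𝓘(ℝ, E) 𝓘(ℝ, ℝ) ∞ (f ∘ Subtype.val : U → ℝ) x ↔
      ContMDiffAt 𝓘(ℝ, E) 𝓘(ℝ, ℝ) ∞ f (x : M) := contMDiffAt_subtype_iff
  unfold IsPrimitiveAt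
  rw [smooth_iff, RoughForm.extendByZero_coe]
  refine and_congr_right fun hf => ?_
  have hdf := (hf.mdifferentiableAt (by simp)).hasMFDerivAt
  have hdf_val : HasMFDerivAt 𝓘(ℝ, E) 𝓘(ℝ, ℝ) (f ∘ Subtype.val) x
      (mfderiv 𝓘(ℝ, E) 𝓘(ℝ, ℝ) f (x : M) : E →L[ℝ] ℝ) := hdf.comp x (hasMFDerivAt_subtype_val x)
  constructor <;> intro h
  · exact hdf.congr_mfderiv (hasMFDerivAt_unique (f := f ∘ Subtype.val) (x := x) hdf_val h)
  · exact hdf_val.congr_mfderiv (hasMFDerivAt_unique hdf h)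

variable [IsManifold 𝓘(ℝ, E) ∞ M] [T2Space M]

lemma extendByZero_mem_closedFormsExactAtInfinity {β : RoughForm E U 1}
    (hβ : β ∈ closedForms E U 1) {L : Set U} (hL : IsCompact L) (hβL : ∀ x ∉ L, β x = 0) :
    β.extendByZero ∈ closedFormsExactAtInfinity E M 1 := by
  have hL' : IsCompact (Subtype.val '' L) := hL.image continuous_subtype_val
  have primitive_zero : ∀ x ∈ (Subtype.val '' L)ᶜ,
      IsPrimitiveAt (fun _ => 0) β.extendByZero x := fun x hx =>
    (isPrimitiveAt_const 0 x).congr_form (RoughForm.extendByZero_eq_zero hβL hx)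
  refine ⟨mem_closedForms_of_forall_eventually_isPrimitiveAt fun x => ?_, _, hL',
    (isExactOn_iff_exists_isPrimitiveAt hL'.isClosed.isOpen_compl).2 ⟨_, primitive_zero⟩⟩
  by_cases hx : x ∈ U
  · lift x to U using hx
    obtain ⟨f, hf⟩ := mem_closedForms_iff_forall_eventually_isPrimitiveAt.1 hβ x
    refine ⟨Function.extend Subtype.val f 0, ?_⟩
    rw [← U.isOpen.isOpenEmbedding_subtypeVal.map_nhds_eq, Filter.eventually_map]
    refine hf.mono fun z hz => isPrimitiveAt_comp_val_iff.1 ?_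
    rwa [Function.extend_comp Subtype.val_injective]
  · exact ⟨_, Filter.eventually_of_mem (hL'.isClosed.isOpen_compl.mem_nhds fun hxL =>
      hx (Subtype.coe_image_subset _ _ hxL)) primitive_zero⟩

lemma c_one_opens_eq_zero [FiniteDimensional ℝ E] [SecondCountableTopology M]
    (hM : c E M 1 = 0) (U : TopologicalSpace.Opens M) : c E U 1 = 0 := by
  have : LocallyCompactSpace U := ChartedSpace.locallyCompactSpace E U
  refine c_eq_zero_iff.2 ?_
  rintro α ⟨hα, K, hK, hαK⟩
  obtain ⟨η, hη, L, hL, hηL⟩ := exists_mem_exactForms_eq_off_compact hK hαK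
  have extension_exact : (α - η).extendByZero ∈ exactForms E M 1 :=
    c_eq_zero_iff.1 hM <| extendByZero_mem_closedFormsExactAtInfinity
      (Submodule.sub_mem _ hα (exactForms_one_le_closedForms_one hη)) hL
      fun x hx => sub_eq_zero.2 (hηL x hx).symm
  obtain ⟨f, hf⟩ := mem_exactForms_one_iff.1 extension_exact
  have difference_exact : α - η ∈ exactForms E U 1 :=
    mem_exactForms_one_iff.2 ⟨f ∘ Subtype.val, fun x => isPrimitiveAt_comp_val_iff.2 (hf x)⟩
  rw [← sub_add_cancel α η]
  exact Submodule.add_mem _ difference_exact hη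

end OpenSubset

end OpenGenus

end

theorem mainTheorem10_general {F : Type*} [NormedAddCommGroup F] [InnerProductSpace ℝ F] {n : ℕ}
    [Fact (Module.finrank ℝ F = n + 1)] (hn : 2 ≤ n)
    (U : TopologicalSpace.Opens (Metric.sphere (0 : F) 1)) :
    OpenGenus.c (EuclideanSpace ℝ (Fin n)) U 1 = 0 := by
  have : FiniteDimensional ℝ F := .of_fact_finrank_eq_succ n
  have c_sphere : OpenGenus.c (EuclideanSpace ℝ (Fin n)) (Metric.sphere (0 : F) 1) 1 = 0 :=
    OpenGenus.c_eq_zero_iff.2 fun _ hα => OpenGenus.closedForms_one_le_exactForms_one_sphere hn hα.1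
  exact OpenGenus.c_one_opens_eq_zero c_sphere U

theorem mainTheorem10
    (U : TopologicalSpace.Opens (Metric.sphere (0 : EuclideanSpace ℝ (Fin 3)) 1)) :
    OpenGenus.c (EuclideanSpace ℝ (Fin 2)) U 1 = 0 :=
  have : Fact (Module.finrank ℝ (EuclideanSpace ℝ (Fin 3)) = 2 + 1) :=
    ⟨finrank_euclideanSpace_fin⟩
  mainTheorem10_general le_rfl U
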